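/- **Theorem (Cantor-type approximation of the Sierpiński gasket).** Let $O_1=(-\tfrac12,0)$, $O_2=(\tfrac12,0)$, $O_3=(0,\tfrac{\sqrt3}{2})$ in the Euclidean plane $(\mathbb{R}^2,d^E)$, and let $F_i(y)=\tfrac12(y-O_i)+O_i$ for $i=1,2,3$. Let $K$ be the Sierpiński gasket, i.e. the unique non-empty compact set with $K=F_1(K)\cup F_2(K)\cup F_3(K)$. Let $D_0$ be the convex hull of $\{O_1,O_2,O_3\}$ (the filled unit triangle) and $D_{n+1}=F_1(D_n)\cup F_2(D_n)\cup F_3(D_n)$ for $n\ge 0$. Let $d^K$ and $d^D_n$ be the intrinsic (geodesic) metrics induced by $d^E$ on $K$ and $D_n$: the distance of two points is the infimum of the Euclidean lengths of the continuous curves that join them inside $K$, respectively inside $D_n$. Then $d^K$ and all $d^D_n$ are finite, and for arbitrary sequences $a_n\in D_n$, $b_n\in D_n$ and points $a,b\in K$ with $a_n\to a$ and $b_n\to b$ in $d^E$, $$d^D_n(a_n,b_n)\to d^K(a,b)\qquad (n\to\infty).$$ -/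

import Mathlib

open Filter Topology
open scoped ENNReal

noncomputable section

/-- The Hutchinson operator `A ↦ ⋃ i, F i (A)` of a family of maps `F`. -/
def hutchinson {ι X : Type*} (F : ι → X → X) (A : Set X) : Set X := ⋃ i, F i '' A

/-- The length (total variation) of a continuous curve. -/
def curveLength {X : Type*} [PseudoEMetricSpace X] {a b : X} (γ : Path a b) : ℝ≥0∞ :=
  eVariationOn γ Set.univ

/-- The intrinsic distance on `A ⊆ X`, with values in `[0, ∞]`: the infimum of the lengths of the
continuous curves from `a` to `b` that stay in `A` (it is `∞` if there is none of finite
length). -/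
def intrinsicEDist {X : Type*} [PseudoEMetricSpace X] (A : Set X) (a b : X) : ℝ≥0∞ :=
  ⨅ (γ : Path a b) (_ : Set.range γ ⊆ A), curveLength γ

/-- The real-valued intrinsic (geodesic) distance on `A`; meaningful when `intrinsicEDist A a b`
is finite. -/
def intrinsicDist {X : Type*} [PseudoEMetricSpace X] (A : Set X) (a b : X) : ℝ :=
  (intrinsicEDist A a b).toReal

namespace Sierpinski

/-- The vertices `(-1/2, 0)`, `(1/2, 0)`, `(0, √3/2)` of the unit triangle. -/
def O : Fin 3 → EuclideanSpace ℝ (Fin 2) :=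
  ![!₂[-(1 / 2 : ℝ), 0], !₂[(1 / 2 : ℝ), 0], !₂[(0 : ℝ), Real.sqrt 3 / 2]]

/-- The contractions `F i` of ratio `1/2` that fix the vertices. -/
def F (i : Fin 3) (y : EuclideanSpace ℝ (Fin 2)) : EuclideanSpace ℝ (Fin 2) :=
  (1 / 2 : ℝ) • (y - O i) + O i

/-- The Cantor-type pre-fractals: `D 0` is the filled unit triangle and
`D (n + 1) = F 0 (D n) ∪ F 1 (D n) ∪ F 2 (D n)`. -/
def D : ℕ → Set (EuclideanSpace ℝ (Fin 2))
  | 0 => convexHull ℝ (Set.range O)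
  | n + 1 => hutchinson F (D n)

/-- The Sierpinski gasket, as the intersection of the pre-fractals. By
`eq_gasket_iff` below it is the unique nonempty compact set that is fixed by the Hutchinson
operator. -/
def gasket : Set (EuclideanSpace ℝ (Fin 2)) := ⋂ n, D n

/-! The rest of this file checks that `gasket` is the attractor of the system `F`. -/

theorem dist_F (i : Fin 3) (x y : EuclideanSpace ℝ (Fin 2)) :
    dist (F i x) (F i y) = dist x y / 2 := by
  have h : F i x - F i y = (1 / 2 : ℝ) • (x - y) := by
    simp only [F]
    module
  rw [dist_eq_norm, h, norm_smul, dist_eq_norm]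
  norm_num
  ring

theorem continuous_F (i : Fin 3) : Continuous (F i) := by
  unfold F
  fun_prop

theorem injective_F (i : Fin 3) : Function.Injective (F i) := by
  intro x y h
  have h1 := dist_F i x y
  rw [h, dist_self] at h1
  exact dist_eq_zero.1 (by linarith)

theorem F_O (i : Fin 3) : F i (O i) = O i := by simp [F]

theorem mem_hutchinson {A : Set (EuclideanSpace ℝ (Fin 2))} {x : EuclideanSpace ℝ (Fin 2)} :
    x ∈ hutchinson F A ↔ ∃ i, ∃ y ∈ A, F i y = x := by
  simp [hutchinson]

theorem D_succ_subset (n : ℕ) : D (n + 1) ⊆ D n := by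
  induction n with
  | zero =>
    intro x hx
    obtain ⟨i, y, hy, rfl⟩ := mem_hutchinson.1 hx
    have hO : O i ∈ convexHull ℝ (Set.range O) := subset_convexHull ℝ _ ⟨i, rfl⟩
    have h := (convex_convexHull ℝ (Set.range O)) hy hO (a := 1 / 2) (b := 1 / 2)
      (by norm_num) (by norm_num) (by norm_num)
    have e : F i y = (1 / 2 : ℝ) • y + (1 / 2 : ℝ) • O i := by
      simp only [F]
      module
    rw [e]
    exact h
  | succ n ih =>
    intro x hx
    obtain ⟨i, y, hy, rfl⟩ := mem_hutchinson.1 hx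
    exact mem_hutchinson.2 ⟨i, y, ih hy, rfl⟩

theorem antitone_D : Antitone D := antitone_nat_of_succ_le D_succ_subset

theorem isCompact_D (n : ℕ) : IsCompact (D n) := by
  induction n with
  | zero => exact (Set.finite_range O).isCompact_convexHull ℝ
  | succ n ih => exact isCompact_iUnion fun i => ih.image (continuous_F i)

theorem O_mem_D (i : Fin 3) (n : ℕ) : O i ∈ D n := by
  induction n with
  | zero => exact subset_convexHull ℝ _ ⟨i, rfl⟩
  | succ n ih => exact mem_hutchinson.2 ⟨i, O i, ih, F_O i⟩

theorem gasket_nonempty : gasket.Nonempty := ⟨O 0, Set.mem_iInter.2 (O_mem_D 0)⟩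

theorem isCompact_gasket : IsCompact gasket :=
  (isCompact_D 0).of_isClosed_subset (isClosed_iInter fun n => (isCompact_D n).isClosed)
    (Set.iInter_subset _ 0)

theorem hutchinson_gasket : hutchinson F gasket = gasket := by
  apply Set.Subset.antisymm
  · intro x hx
    obtain ⟨i, y, hy, rfl⟩ := mem_hutchinson.1 hx
    exact Set.mem_iInter.2 fun n =>
      D_succ_subset n (mem_hutchinson.2 ⟨i, y, Set.mem_iInter.1 hy n, rfl⟩)
  · intro x hx
    by_contra hne
    have hx' : ∀ n, x ∈ D n := Set.mem_iInter.1 hx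
    have key : ∀ i, ∃ n, ∀ y ∈ D n, F i y ≠ x := by
      intro i
      by_contra! hc
      obtain ⟨y, hy, hyx⟩ := hc 0
      refine hne (mem_hutchinson.2 ⟨i, y, Set.mem_iInter.2 fun n => ?_, hyx⟩)
      obtain ⟨z, hz, hzx⟩ := hc n
      rwa [injective_F i (hyx.trans hzx.symm)]
    choose N hN using key
    obtain ⟨i, y, hy, hyx⟩ := mem_hutchinson.1 (hx' ((Finset.univ.sup N) + 1))
    exact hN i y (antitone_D (Finset.le_sup (Finset.mem_univ i)) hy) hyx

theorem subset_of_fixed {A B : Set (EuclideanSpace ℝ (Fin 2))} (hA : IsCompact A)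
    (hB : IsCompact B) (hBn : B.Nonempty) (hFA : hutchinson F A = A) (hFB : hutchinson F B = B) :
    A ⊆ B := by
  intro a ha
  obtain ⟨x, hx, hmax⟩ := hA.exists_isMaxOn ⟨a, ha⟩
    (Metric.continuous_infDist_pt B).continuousOn
  rw [← hFA] at hx
  obtain ⟨i, x', hx', rfl⟩ := mem_hutchinson.1 hx
  obtain ⟨y, hy, hxy⟩ := hB.exists_infDist_eq_dist hBn x'
  have hFy : F i y ∈ B := by
    rw [← hFB]
    exact mem_hutchinson.2 ⟨i, y, hy, rfl⟩
  have h1 : Metric.infDist (F i x') B ≤ dist x' y / 2 :=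
    (Metric.infDist_le_dist_of_mem hFy).trans_eq (dist_F i x' y)
  have h2 : Metric.infDist x' B ≤ Metric.infDist (F i x') B := hmax hx'
  have h3 : Metric.infDist a B ≤ Metric.infDist (F i x') B := hmax ha
  have h4 : 0 ≤ Metric.infDist a B := Metric.infDist_nonneg
  rw [hB.isClosed.mem_iff_infDist_zero hBn]
  linarith

/-- The gasket is the unique nonempty compact set fixed by the Hutchinson operator. -/
theorem eq_gasket_iff (K : Set (EuclideanSpace ℝ (Fin 2))) :
    K = gasket ↔ K.Nonempty ∧ IsCompact K ∧ hutchinson F K = K := by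
  constructor
  · rintro rfl
    exact ⟨gasket_nonempty, isCompact_gasket, hutchinson_gasket⟩
  · rintro ⟨hn, hc, hf⟩
    exact Set.Subset.antisymm
      (subset_of_fixed hc isCompact_gasket gasket_nonempty hf hutchinson_gasket)
      (subset_of_fixed isCompact_gasket hc hn hutchinson_gasket hf)

end Sierpinski

end

/-! Lower bound: if infinitely many $d^D_n(a_n,b_n)$ are below $L$, the corresponding curves can be
reparametrized as $L$-Lipschitz maps on $[0,1]$. A pointwise limit of them is again $L$-Lipschitz,
joins $a$ to $b$ and lies in every $D_m$, hence in $K$; so $d^K(a,b)\le L$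
(`intrinsicEDist_iInter_le_of_frequently`). Upper bound: $K\subseteq D_n$ gives $d^D_n(a,b)\le
d^K(a,b)$, and moving the endpoints to $a_n$, $b_n$ costs at most $4\,(d^E(a_n,a)+d^E(b_n,b))$,
because $d^D_n\le 4\,d^E$ with a constant independent of $n$ (`intrinsicEDist_D_le`). That
comparison is by induction on $n$: inside one cell it scales, and two different cells are joined
through their common vertex, where the 60° angles keep the detour comparable to the straight
distance. -/

section IntrinsicDistance

open scoped NNReal

/-! ### Calculus of intrinsic distances. -/

theorem intrinsicEDist_mono {X : Type*} [PseudoEMetricSpace X] {A B : Set X} (h : A ⊆ B)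
    (x y : X) : intrinsicEDist B x y ≤ intrinsicEDist A x y :=
  le_iInf₂ fun γ hγ => iInf₂_le γ (hγ.trans h)

theorem curveLength_symm_le {X : Type*} [PseudoEMetricSpace X] {x y : X} (γ : Path x y) :
    curveLength γ.symm ≤ curveLength γ :=
  eVariationOn.comp_le_of_antitoneOn γ unitInterval.symm
    (fun _ _ _ _ h => unitInterval.symm_le_symm.2 h) (Set.mapsTo_univ _ _)

theorem intrinsicEDist_comm {X : Type*} [PseudoEMetricSpace X] (A : Set X) (x y : X) :
    intrinsicEDist A x y = intrinsicEDist A y x := by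
  have key : ∀ x y : X, intrinsicEDist A x y ≤ intrinsicEDist A y x := fun x y =>
    le_iInf₂ fun γ hγ => (iInf₂_le γ.symm (by rwa [Path.symm_range])).trans (curveLength_symm_le γ)
  exact (key x y).antisymm (key y x)

theorem curveLength_trans_le {X : Type*} [PseudoEMetricSpace X] {x y z : X} (γ : Path x y)
    (γ' : Path y z) : curveLength (γ.trans γ') ≤ curveLength γ + curveLength γ' := by
  let m : unitInterval := ⟨1 / 2, by norm_num, by norm_num⟩
  have hu : (Set.univ : Set unitInterval) = Set.Iic m ∪ Set.Ici m := Set.Iic_union_Ici.symm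
  unfold curveLength
  rw [hu, eVariationOn.union (γ.trans γ') isGreatest_Iic isLeast_Ici, ← hu]
  gcongr
  · have e : Set.EqOn (γ.trans γ')
        (γ ∘ fun t : unitInterval => Set.projIcc (0 : ℝ) 1 zero_le_one (2 * t)) (Set.Iic m) := by
      intro t ht
      have ht' : (t : ℝ) ≤ 1 / 2 := ht
      rw [Path.trans_apply, dif_pos ht', Function.comp_apply,
        Set.projIcc_of_mem zero_le_one ⟨by linarith [t.2.1], by linarith⟩]
    rw [eVariationOn.congr e]
    refine eVariationOn.comp_le_of_monotoneOn γ _ (fun s _ t _ h => ?_) (Set.mapsTo_univ _ _)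
    have h' : (s : ℝ) ≤ t := h
    exact Set.monotone_projIcc _ (by linarith)
  · have e : Set.EqOn (γ.trans γ')
        (γ' ∘ fun t : unitInterval => Set.projIcc (0 : ℝ) 1 zero_le_one (2 * t - 1))
        (Set.Ici m) := by
      intro t ht
      have ht' : 1 / 2 ≤ (t : ℝ) := ht
      rw [Path.trans_apply, Function.comp_apply,
        Set.projIcc_of_mem zero_le_one ⟨by linarith, by linarith [t.2.2]⟩]
      split_ifs with h
      · have h2 : (t : ℝ) = 1 / 2 := le_antisymm h ht'
        simp [h2]
      · rfl
    rw [eVariationOn.congr e]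
    refine eVariationOn.comp_le_of_monotoneOn γ' _ (fun s _ t _ h => ?_) (Set.mapsTo_univ _ _)
    have h' : (s : ℝ) ≤ t := h
    exact Set.monotone_projIcc _ (by linarith)

theorem intrinsicEDist_triangle {X : Type*} [PseudoEMetricSpace X] (A : Set X) (x y z : X) :
    intrinsicEDist A x z ≤ intrinsicEDist A x y + intrinsicEDist A y z := by
  simp only [intrinsicEDist, ENNReal.iInf_add, ENNReal.add_iInf]
  refine le_iInf₂ fun γ' hγ' => le_iInf₂ fun γ hγ => ?_
  refine (iInf₂_le (γ.trans γ') ?_).trans (curveLength_trans_le γ γ')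
  rw [Path.trans_range]
  exact Set.union_subset hγ hγ'

theorem LipschitzWith.intrinsicEDist_image_le {X Y : Type*} [PseudoEMetricSpace X]
    [PseudoEMetricSpace Y] {C : ℝ≥0} {f : X → Y} (hf : LipschitzWith C f) (hC : C ≠ 0) (A : Set X)
    (x y : X) : intrinsicEDist (f '' A) (f x) (f y) ≤ C * intrinsicEDist A x y := by
  -- `C ≠ 0` matters when no curve is admissible: the infimum is then `∞`, and `0 * ∞ = 0`.
  simp only [intrinsicEDist, ENNReal.mul_iInf_of_ne (ENNReal.coe_ne_zero.2 hC) ENNReal.coe_ne_top]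
  refine le_iInf₂ fun γ hγ => (iInf₂_le (γ.map hf.continuous) ?_).trans ?_
  · rw [Path.map_coe, Set.range_comp]
    exact Set.image_mono hγ
  · exact hf.lipschitzOnWith.comp_eVariationOn_le (Set.mapsTo_univ _ _)

theorem intrinsicEDist_le_of_lipschitzWith {X : Type*} [PseudoEMetricSpace X] {A : Set X} {x y : X}
    {L : ℝ≥0} {f : unitInterval → X} (hf : LipschitzWith L f) (h0 : f 0 = x) (h1 : f 1 = y)
    (hA : ∀ t, f t ∈ A) : intrinsicEDist A x y ≤ L := by
  let γ : Path x y := ⟨⟨f, hf.continuous⟩, h0, h1⟩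
  have hγ : Set.range γ ⊆ A := Set.range_subset_iff.2 hA
  refine (iInf₂_le γ hγ).trans ?_
  have hid : eVariationOn (fun t : unitInterval => (t : ℝ)) Set.univ ≤ 1 := by
    have h := (MonotoneOn.eVariationOn_eq (f := fun t : unitInterval => (t : ℝ)) (s := Set.univ)
      (fun _ _ _ _ h => h) (Set.mem_univ 0) (Set.mem_univ 1)).le
    have e : Set.univ ∩ Set.Icc (0 : unitInterval) 1 = Set.univ :=
      (Set.univ_inter _).trans (Set.eq_univ_of_forall fun t => ⟨t.2.1, t.2.2⟩)
    rw [e] at h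
    simpa using h
  calc curveLength γ = eVariationOn (f ∘ id) Set.univ := rfl
    _ ≤ L * eVariationOn (id : unitInterval → unitInterval) Set.univ :=
      hf.lipschitzOnWith.comp_eVariationOn_le (Set.mapsTo_univ _ _)
    _ ≤ L * 1 := by gcongr; exact hid
    _ = L := mul_one _

theorem intrinsicEDist_le_edist_of_segment_subset {E : Type*} [NormedAddCommGroup E]
    [NormedSpace ℝ E] {A : Set E} {x y : E} (h : segment ℝ x y ⊆ A) :
    intrinsicEDist A x y ≤ edist x y := by
  have hl : LipschitzWith (nndist x y * 1)
      (AffineMap.lineMap x y ∘ (Subtype.val : unitInterval → ℝ)) :=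
    (lipschitzWith_lineMap x y).comp (LipschitzWith.subtype_val _)
  refine (intrinsicEDist_le_of_lipschitzWith hl (by simp) (by simp) fun t => h ?_).trans_eq ?_
  · rw [segment_eq_image_lineMap]
    exact ⟨t, t.2, rfl⟩
  · rw [mul_one, edist_nndist]

/-! ### Reparametrization by arc length. -/

/-- The one-sided jumps of the variation function are the jumps of `f`, which vanish by continuity.
-/
theorem continuous_variationOnFromTo {E : Type*} [PseudoMetricSpace E] {f : unitInterval → E}
    (hf : Continuous f) (hv : LocallyBoundedVariationOn f Set.univ) :
    Continuous (variationOnFromTo f Set.univ 0) := by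
  refine continuous_iff_continuousAt.2 fun b => ?_
  refine continuousAt_iff_continuous_left'_right'.2 ⟨?_, ?_⟩
  · have h := variationOnFromTo.tendsto_left (Set.mem_univ (0 : unitInterval)) (Set.mem_univ b) hv
      (hf.continuousWithinAt (s := Set.univ ∩ Set.Iio b) (x := b))
    rwa [dist_self, sub_zero, Set.univ_inter] at h
  · have h := variationOnFromTo.tendsto_right (Set.mem_univ (0 : unitInterval)) (Set.mem_univ b) hv
      (hf.continuousWithinAt (s := Set.univ ∩ Set.Ioi b) (x := b))
    rwa [dist_self, add_zero, Set.univ_inter] at h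

theorem dist_le_abs_variationOnFromTo_sub {E : Type*} [PseudoMetricSpace E] {f : unitInterval → E}
    (hv : LocallyBoundedVariationOn f Set.univ) (s t : unitInterval) :
    dist (f s) (f t) ≤
      |variationOnFromTo f Set.univ 0 s - variationOnFromTo f Set.univ 0 t| := by
  wlog hst : s ≤ t generalizing s t
  · rw [dist_comm, abs_sub_comm]
    exact this t s (le_of_not_ge hst)
  rw [abs_sub_comm]
  refine le_trans ?_ (le_abs_self _)
  rw [variationOnFromTo.sub_right hv (Set.mem_univ _) (Set.mem_univ _) (Set.mem_univ _),
    variationOnFromTo.eq_of_le _ _ hst, dist_edist]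
  exact ENNReal.toReal_mono (hv s t (Set.mem_univ _) (Set.mem_univ _))
    (eVariationOn.edist_le f ⟨Set.mem_univ _, le_rfl, hst⟩ ⟨Set.mem_univ _, hst, le_rfl⟩)

/-- Every continuous curve of finite length has a Lipschitz reparametrization. -/
theorem exists_lipschitzWith_of_curveLength_le {X : Type*} [MetricSpace X] {x y : X} (γ : Path x y)
    {L : ℝ≥0} (hL : curveLength γ ≤ L) :
    ∃ f : unitInterval → X, LipschitzWith L f ∧ f 0 = x ∧ f 1 = y ∧
      Set.range f ⊆ Set.range γ := by
  have hb : BoundedVariationOn γ Set.univ := ne_top_of_le_ne_top ENNReal.coe_ne_top hL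
  have hv := hb.locallyBoundedVariationOn
  set v := variationOnFromTo γ Set.univ 0
  have hd : ∀ s t, dist (γ s) (γ t) ≤ |v s - v t| := dist_le_abs_variationOnFromTo_sub hv
  have hv0 : v 0 = 0 := variationOnFromTo.self _ _ _
  have hv1 : 0 ≤ v 1 := variationOnFromTo.nonneg_of_le _ _ zero_le_one
  have hvL : v 1 ≤ L :=
    (le_abs_self _).trans ((variationOnFromTo.abs_le_eVariationOn hb).trans
      (ENNReal.toReal_mono ENNReal.coe_ne_top hL))
  -- `τ t` is a time at which the fraction `t` of the length has been covered. It need not be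
  -- continuous, but `γ ∘ τ` is Lipschitz, since arc length dominates distance.
  have hsurj : ∀ t : unitInterval, ∃ s, v s = v 1 * t := fun t =>
    mem_range_of_exists_le_of_exists_ge (continuous_variationOnFromTo γ.continuous hv)
      ⟨0, by rw [hv0]; exact mul_nonneg hv1 t.2.1⟩
      ⟨1, mul_le_of_le_one_right hv1 t.2.2⟩
  choose τ hτ using hsurj
  refine ⟨γ ∘ τ, LipschitzWith.of_dist_le_mul fun s t => ?_, ?_, ?_, Set.range_comp_subset_range _ _⟩
  · refine (hd _ _).trans ?_
    rw [hτ, hτ, ← mul_sub, abs_mul, abs_of_nonneg hv1, Subtype.dist_eq, Real.dist_eq]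
    gcongr
  · have h := hd (τ 0) 0
    rw [hτ, hv0, γ.source] at h
    exact dist_le_zero.1 (by simpa using h)
  · have h := hd (τ 1) 1
    rw [hτ, γ.target] at h
    exact dist_le_zero.1 (by simpa using h)

theorem exists_lipschitzWith_of_intrinsicEDist_lt {X : Type*} [MetricSpace X] {A : Set X} {x y : X}
    {L : ℝ≥0} (h : intrinsicEDist A x y < L) :
    ∃ f : unitInterval → X, LipschitzWith L f ∧ f 0 = x ∧ f 1 = y ∧ ∀ t, f t ∈ A := by
  simp only [intrinsicEDist, iInf_lt_iff] at h
  obtain ⟨γ, hγ, hlt⟩ := h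
  obtain ⟨f, hf, h0, h1, hr⟩ := exists_lipschitzWith_of_curveLength_le γ hlt.le
  exact ⟨f, hf, h0, h1, fun t => hγ (hr ⟨t, rfl⟩)⟩

/-! ### Limits along decreasing compact sets. -/

/-- Lower semicontinuity of intrinsic distances along a decreasing sequence of compact sets. -/
theorem intrinsicEDist_iInter_le_of_frequently {X : Type*} [MetricSpace X] {A : ℕ → Set X}
    (hA : Antitone A) (hc : ∀ n, IsCompact (A n)) {a b : ℕ → X} {x y : X}
    (ha : Tendsto a atTop (𝓝 x)) (hb : Tendsto b atTop (𝓝 y)) {L : ℝ≥0}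
    (h : ∃ᶠ n in atTop, intrinsicEDist (A n) (a n) (b n) < L) :
    intrinsicEDist (⋂ n, A n) x y ≤ L := by
  set S := {n | intrinsicEDist (A n) (a n) (b n) < L}
  have : (atTop ⊓ 𝓟 S).NeBot := frequently_mem_iff_neBot.1 h
  -- Along an ultrafilter, compactness of `A 0` gives pointwise limits at all times at once, so no
  -- subsequence has to be extracted.
  let U := Ultrafilter.of (atTop ⊓ 𝓟 S)
  have hU : (U : Filter ℕ) ≤ atTop ⊓ 𝓟 S := Ultrafilter.of_le _
  have hUtop : (U : Filter ℕ) ≤ atTop := hU.trans inf_le_left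
  have hUS : ∀ᶠ n in (U : Filter ℕ), n ∈ S := hU.trans inf_le_right (mem_principal_self S)
  have hex : ∀ n, ∃ f : unitInterval → X, n ∈ S →
      LipschitzWith L f ∧ f 0 = a n ∧ f 1 = b n ∧ ∀ t, f t ∈ A n := by
    intro n
    by_cases hn : n ∈ S
    · obtain ⟨f, hf⟩ := exists_lipschitzWith_of_intrinsicEDist_lt hn
      exact ⟨f, fun _ => hf⟩
    · exact ⟨fun _ => x, fun h => absurd h hn⟩
  choose f hf using hex
  have hmem : ∀ m t, ∀ᶠ n in (U : Filter ℕ), f n t ∈ A m := fun m t => by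
    filter_upwards [hUS, hUtop (eventually_ge_atTop m)] with n hn hmn
    exact hA hmn ((hf n hn).2.2.2 t)
  have hlim : ∀ t, ∃ p, Tendsto (fun n => f n t) U (𝓝 p) := fun t => by
    obtain ⟨p, -, hp⟩ := (hc 0).ultrafilter_le_nhds (U.map fun n => f n t)
      (le_principal_iff.2 (hmem 0 t))
    exact ⟨p, hp⟩
  choose g hg using hlim
  refine intrinsicEDist_le_of_lipschitzWith (f := g) (fun s t => ?_) ?_ ?_ fun t =>
    Set.mem_iInter.2 fun m => (hc m).isClosed.mem_of_tendsto (hg t) (hmem m t)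
  · refine le_of_tendsto ((hg s).edist (hg t)) ?_
    filter_upwards [hUS] with n hn using (hf n hn).1 s t
  · refine tendsto_nhds_unique (hg 0) ((ha.mono_left hUtop).congr' ?_)
    filter_upwards [hUS] with n hn using (hf n hn).2.1.symm
  · refine tendsto_nhds_unique (hg 1) ((hb.mono_left hUtop).congr' ?_)
    filter_upwards [hUS] with n hn using (hf n hn).2.2.1.symm

/-- If the intrinsic distances of a decreasing sequence of compact sets are uniformly comparable
to the ambient distance, then they converge to the intrinsic distance of the intersection. -/
theorem tendsto_intrinsicEDist_iInter {X : Type*} [MetricSpace X] {A : ℕ → Set X}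
    (hA : Antitone A) (hc : ∀ n, IsCompact (A n)) {C : ℝ≥0}
    (hC : ∀ n, ∀ x ∈ A n, ∀ y ∈ A n, intrinsicEDist (A n) x y ≤ C * edist x y) {a b : ℕ → X}
    {x y : X} (han : ∀ n, a n ∈ A n) (hbn : ∀ n, b n ∈ A n) (hx : x ∈ ⋂ n, A n)
    (hy : y ∈ ⋂ n, A n) (ha : Tendsto a atTop (𝓝 x)) (hb : Tendsto b atTop (𝓝 y)) :
    Tendsto (fun n => intrinsicEDist (A n) (a n) (b n)) atTop
      (𝓝 (intrinsicEDist (⋂ n, A n) x y)) := by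
  rw [Set.mem_iInter] at hx hy
  refine tendsto_of_le_liminf_of_limsup_le ?_ ?_
  · refine le_of_forall_lt fun c hc' => ?_
    obtain ⟨r, hcr, hr⟩ := ENNReal.lt_iff_exists_nnreal_btwn.1 hc'
    refine hcr.trans_le (le_liminf_of_le (by isBoundedDefault) ?_)
    by_contra hne
    refine hr.not_ge (intrinsicEDist_iInter_le_of_frequently hA hc ha hb ?_)
    exact (not_eventually.1 hne).mono fun n hn => not_le.1 hn
  · have hub : ∀ n, intrinsicEDist (A n) (a n) (b n) ≤
        C * edist (a n) x + intrinsicEDist (⋂ n, A n) x y + C * edist y (b n) := fun n =>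
      calc intrinsicEDist (A n) (a n) (b n)
          ≤ intrinsicEDist (A n) (a n) x + intrinsicEDist (A n) x y
            + intrinsicEDist (A n) y (b n) :=
            (intrinsicEDist_triangle _ _ y _).trans
              (by gcongr; exact intrinsicEDist_triangle _ _ _ _)
        _ ≤ _ := by
            gcongr
            · exact hC n _ (han n) _ (hx n)
            · exact intrinsicEDist_mono (Set.iInter_subset _ n) _ _
            · exact hC n _ (hy n) _ (hbn n)
    have h1 : Tendsto (fun n => (C : ℝ≥0∞) * edist (a n) x) atTop (𝓝 0) := by
      have := ENNReal.Tendsto.const_mul (a := (C : ℝ≥0∞)) (ha.edist (tendsto_const_nhds (x := x)))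
        (Or.inr ENNReal.coe_ne_top)
      simpa using this
    have h2 : Tendsto (fun n => (C : ℝ≥0∞) * edist y (b n)) atTop (𝓝 0) := by
      have := ENNReal.Tendsto.const_mul (a := (C : ℝ≥0∞)) ((tendsto_const_nhds (x := y)).edist hb)
        (Or.inr ENNReal.coe_ne_top)
      simpa using this
    have h3 := (h1.add (tendsto_const_nhds (x := intrinsicEDist (⋂ n, A n) x y))).add h2
    rw [zero_add, add_zero] at h3
    rw [← h3.limsup_eq]
    exact limsup_le_limsup (Eventually.of_forall hub)

end IntrinsicDistance

/-! ### Geometry of the triangle and its cells. -/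

namespace Sierpinski

theorem lipschitzWith_F (i : Fin 3) : LipschitzWith (1 / 2) (F i) :=
  LipschitzWith.of_dist_le_mul fun x y => by
    rw [dist_F]
    push_cast
    linarith

/-- Both sides are the midpoint of `O i` and `O j`, the vertex shared by cells `i` and `j`. -/
theorem F_O_comm (i j : Fin 3) : F i (O j) = F j (O i) := by
  simp only [F]
  module

theorem dist_O {i j : Fin 3} (h : i ≠ j) : dist (O i) (O j) = 1 := by
  have h3 : Real.sqrt 3 ^ 2 = 3 := Real.sq_sqrt (by norm_num)
  rw [EuclideanSpace.dist_eq, Real.sqrt_eq_one, Fin.sum_univ_two, Real.dist_eq, Real.dist_eq,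
    sq_abs, sq_abs]
  fin_cases i <;> fin_cases j <;> first | exact absurd rfl h | norm_num [O, div_pow, h3]

theorem inner_O_sub_O {i j k : Fin 3} (hij : i ≠ j) (hkj : k ≠ j) :
    1 / 2 ≤ inner ℝ (O k - O j) (O i - O j) := by
  have h := norm_sub_sq_real (O k - O j) (O i - O j)
  rw [sub_sub_sub_cancel_right, ← dist_eq_norm, ← dist_eq_norm, ← dist_eq_norm, dist_O hij,
    dist_O hkj] at h
  have hki : dist (O k) (O i) ≤ 1 := by
    rcases eq_or_ne k i with rfl | hki
    · simp
    · exact (dist_O hki).le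
  have : dist (O k) (O i) ^ 2 ≤ 1 := pow_le_one₀ dist_nonneg hki
  linarith

/-- The triangle subtends an angle of at most `π / 3` with each edge at each of its vertices. -/
theorem norm_sub_O_le_inner {i j : Fin 3} (hij : i ≠ j) {x : EuclideanSpace ℝ (Fin 2)}
    (hx : x ∈ D 0) : ‖x - O j‖ ≤ 2 * inner ℝ (x - O j) (O i - O j) := by
  -- A convex function bounded by an affine one: only the vertices remain to be checked.
  have hconv : Convex ℝ {x | ‖x - O j‖ ≤ 2 * inner ℝ (x - O j) (O i - O j)} := by
    intro x hx y hy s t hs ht hst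
    simp only [Set.mem_ofPred_eq] at hx hy ⊢
    have e : s • x + t • y - O j = s • (x - O j) + t • (y - O j) := by
      rw [smul_sub, smul_sub, sub_add_sub_comm, ← add_smul, hst, one_smul]
    rw [e, inner_add_left, real_inner_smul_left, real_inner_smul_left]
    have h := norm_add_le (s • (x - O j)) (t • (y - O j))
    rw [norm_smul_of_nonneg hs, norm_smul_of_nonneg ht] at h
    nlinarith [mul_le_mul_of_nonneg_left hx hs, mul_le_mul_of_nonneg_left hy ht]
  refine convexHull_min ?_ hconv hx
  rintro _ ⟨k, rfl⟩
  rcases eq_or_ne k j with rfl | hkj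
  · simp
  · have h := inner_O_sub_O hij hkj
    rw [Set.mem_ofPred_eq, ← dist_eq_norm, dist_O hkj]
    linarith

theorem D_subset_D_zero (n : ℕ) : D n ⊆ D 0 := antitone_D (Nat.zero_le n)

theorem half_le_dist_F_O {i j : Fin 3} (hij : i ≠ j) {x : EuclideanSpace ℝ (Fin 2)}
    (hx : x ∈ D 0) : 1 / 2 ≤ dist (F i x) (O j) := by
  have h := norm_sub_O_le_inner hij hx
  have h0 := norm_nonneg (x - O j)
  have hn : ‖O i - O j‖ = 1 := by rw [← dist_eq_norm, dist_O hij]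
  have e : F i x - O j = (1 / 2 : ℝ) • (x - O j) + (1 / 2 : ℝ) • (O i - O j) := by
    simp only [F]
    module
  have hi := real_inner_le_norm (F i x - O j) (O i - O j)
  rw [hn, mul_one] at hi
  rw [dist_eq_norm]
  refine le_trans ?_ hi
  rw [e, inner_add_left, real_inner_smul_left, real_inner_smul_left, real_inner_self_eq_norm_sq, hn]
  linarith

/-- Project onto the unit vector `O i - O j`: both legs contribute with the same sign, each at least
half its length. The 4 is this factor 2 times the 2 from the contraction. -/
theorem dist_O_add_dist_O_le {i j : Fin 3} (hij : i ≠ j) {x y : EuclideanSpace ℝ (Fin 2)}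
    (hx : x ∈ D 0) (hy : y ∈ D 0) : dist x (O j) + dist (O i) y ≤ 4 * dist (F i x) (F j y) := by
  have h1 := norm_sub_O_le_inner hij hx
  have h2 := norm_sub_O_le_inner hij.symm hy
  have hn : ‖O i - O j‖ = 1 := by rw [← dist_eq_norm, dist_O hij]
  have e : F i x - F j y = (1 / 2 : ℝ) • ((x - O j) - (y - O i)) := by
    simp only [F]
    module
  have hi := real_inner_le_norm ((x - O j) - (y - O i)) (O i - O j)
  rw [hn, mul_one, inner_sub_left] at hi
  rw [← neg_sub (O i) (O j), inner_neg_right] at h2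
  rw [dist_comm (O i), dist_eq_norm, dist_eq_norm, dist_eq_norm, e,
    norm_smul_of_nonneg (by norm_num)]
  linarith

/-! ### Uniform comparison of the metrics. -/

theorem intrinsicEDist_D_succ_F_le (n : ℕ) (i : Fin 3) (x y : EuclideanSpace ℝ (Fin 2)) :
    intrinsicEDist (D (n + 1)) (F i x) (F i y) ≤ 2⁻¹ * intrinsicEDist (D n) x y := by
  refine (intrinsicEDist_mono (Set.subset_iUnion (fun i => F i '' D n) i) _ _).trans
    (((lipschitzWith_F i).intrinsicEDist_image_le (by norm_num) (D n) x y).trans_eq ?_)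
  norm_num

theorem intrinsicEDist_D_zero_le {x y : EuclideanSpace ℝ (Fin 2)} (hx : x ∈ D 0) (hy : y ∈ D 0) :
    intrinsicEDist (D 0) x y ≤ edist x y :=
  intrinsicEDist_le_edist_of_segment_subset ((convex_convexHull ℝ _).segment_subset hx hy)

theorem intrinsicEDist_D_O_O_le (n : ℕ) (i j : Fin 3) : intrinsicEDist (D n) (O i) (O j) ≤ 1 := by
  induction n with
  | zero =>
    refine (intrinsicEDist_D_zero_le (O_mem_D i 0) (O_mem_D j 0)).trans ?_
    rcases eq_or_ne i j with rfl | h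
    · simp
    · rw [edist_dist, dist_O h, ENNReal.ofReal_one]
  | succ n ih =>
    calc intrinsicEDist (D (n + 1)) (O i) (O j)
        ≤ intrinsicEDist (D (n + 1)) (F i (O i)) (F i (O j))
          + intrinsicEDist (D (n + 1)) (F j (O i)) (F j (O j)) := by
          rw [← F_O_comm i j, F_O, F_O]
          exact intrinsicEDist_triangle _ _ _ _
      _ ≤ 2⁻¹ * 1 + 2⁻¹ * 1 := by
          gcongr <;> exact (intrinsicEDist_D_succ_F_le _ _ _ _).trans (by gcongr)
      _ = 1 := by rw [mul_one, ENNReal.inv_two_add_inv_two]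

/-- Go to the cell's vertex towards `O j`, then on to `O j`; each leg is a half-scale copy of a path
of length at most 1. -/
theorem intrinsicEDist_D_O_le_one (n : ℕ) (j : Fin 3) {x : EuclideanSpace ℝ (Fin 2)}
    (hx : x ∈ D n) : intrinsicEDist (D n) x (O j) ≤ 1 := by
  induction n generalizing x with
  | zero =>
    refine (intrinsicEDist_D_zero_le hx (O_mem_D j 0)).trans ?_
    have h : D 0 ⊆ Metric.closedBall (O j) 1 := by
      refine convexHull_min ?_ (convex_closedBall _ _)
      rintro _ ⟨k, rfl⟩
      rcases eq_or_ne k j with rfl | h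
      · simp
      · exact (dist_O h).le
    rw [edist_dist, ← ENNReal.ofReal_one]
    exact ENNReal.ofReal_le_ofReal (h hx)
  | succ n ih =>
    obtain ⟨i, y, hy, rfl⟩ := mem_hutchinson.1 hx
    calc intrinsicEDist (D (n + 1)) (F i y) (O j)
        ≤ intrinsicEDist (D (n + 1)) (F i y) (F i (O j))
          + intrinsicEDist (D (n + 1)) (F j (O i)) (F j (O j)) := by
          rw [← F_O_comm i j, F_O]
          exact intrinsicEDist_triangle _ _ _ _
      _ ≤ 2⁻¹ * 1 + 2⁻¹ * 1 := by
          gcongr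
          · exact (intrinsicEDist_D_succ_F_le _ _ _ _).trans (by gcongr; exact ih hy)
          · exact (intrinsicEDist_D_succ_F_le _ _ _ _).trans
              (by gcongr; exact intrinsicEDist_D_O_O_le _ _ _)
      _ = 1 := by rw [mul_one, ENNReal.inv_two_add_inv_two]

theorem edist_F (i : Fin 3) (x y : EuclideanSpace ℝ (Fin 2)) :
    edist (F i x) (F i y) = 2⁻¹ * edist x y := by
  rw [edist_dist, dist_F, edist_dist, div_eq_inv_mul, ENNReal.ofReal_mul (by norm_num),
    ENNReal.ofReal_inv_of_pos two_pos, ENNReal.ofReal_ofNat]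

theorem intrinsicEDist_D_O_le (n : ℕ) (j : Fin 3) {x : EuclideanSpace ℝ (Fin 2)}
    (hx : x ∈ D n) : intrinsicEDist (D n) x (O j) ≤ 2 * edist x (O j) := by
  induction n generalizing x with
  | zero =>
    exact (intrinsicEDist_D_zero_le hx (O_mem_D j 0)).trans
      (le_mul_of_one_le_left zero_le one_le_two)
  | succ n ih =>
    obtain ⟨i, y, hy, rfl⟩ := mem_hutchinson.1 hx
    rcases eq_or_ne i j with rfl | hij
    · nth_rw 1 2 [← F_O i]
      rw [edist_F, mul_left_comm]
      exact (intrinsicEDist_D_succ_F_le _ _ _ _).trans (by gcongr; exact ih hy)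
    -- Outside the cell of `O j` the Euclidean distance is at least 1/2, whence the constant 2.
    · refine (intrinsicEDist_D_O_le_one _ j hx).trans ?_
      have h := ENNReal.ofReal_le_ofReal
        (show (1 : ℝ) ≤ 2 * dist (F i y) (O j) by
          linarith [half_le_dist_F_O hij (D_subset_D_zero n hy)])
      rwa [ENNReal.ofReal_one, ENNReal.ofReal_mul two_pos.le, ENNReal.ofReal_ofNat,
        ← edist_dist] at h

/-- The intrinsic metrics of the pre-fractals are uniformly comparable to the Euclidean one. -/
theorem intrinsicEDist_D_le (n : ℕ) {x y : EuclideanSpace ℝ (Fin 2)} (hx : x ∈ D n)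
    (hy : y ∈ D n) : intrinsicEDist (D n) x y ≤ 4 * edist x y := by
  induction n generalizing x y with
  | zero =>
    exact (intrinsicEDist_D_zero_le hx hy).trans
      (le_mul_of_one_le_left zero_le (by norm_num))
  | succ n ih =>
    obtain ⟨i, x, hx', rfl⟩ := mem_hutchinson.1 hx
    obtain ⟨j, y, hy', rfl⟩ := mem_hutchinson.1 hy
    rcases eq_or_ne i j with rfl | hij
    -- Both metrics are halved, so the constant does not grow with `n`.
    · rw [edist_F, mul_left_comm]
      exact (intrinsicEDist_D_succ_F_le _ _ _ _).trans (by gcongr; exact ih hx' hy')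
    · have h2 : (2⁻¹ : ℝ≥0∞) * 2 = 1 := ENNReal.inv_mul_cancel two_ne_zero ENNReal.ofNat_ne_top
      calc intrinsicEDist (D (n + 1)) (F i x) (F j y)
          ≤ intrinsicEDist (D (n + 1)) (F i x) (F i (O j))
            + intrinsicEDist (D (n + 1)) (F j (O i)) (F j y) := by
            rw [← F_O_comm i j]
            exact intrinsicEDist_triangle _ _ _ _
        _ ≤ 2⁻¹ * (2 * edist x (O j)) + 2⁻¹ * (2 * edist (O i) y) := by
            gcongr
            · exact (intrinsicEDist_D_succ_F_le _ _ _ _).trans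
                (by gcongr; exact intrinsicEDist_D_O_le n j hx')
            · refine (intrinsicEDist_D_succ_F_le _ _ _ _).trans ?_
              rw [intrinsicEDist_comm, edist_comm]
              gcongr
              exact intrinsicEDist_D_O_le n i hy'
        _ = ENNReal.ofReal (dist x (O j) + dist (O i) y) := by
            rw [← mul_assoc, ← mul_assoc, h2, one_mul, one_mul, edist_dist, edist_dist,
              ENNReal.ofReal_add dist_nonneg dist_nonneg]
        _ ≤ ENNReal.ofReal (4 * dist (F i x) (F j y)) := ENNReal.ofReal_le_ofReal
            (dist_O_add_dist_O_le hij (D_subset_D_zero n hx') (D_subset_D_zero n hy'))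
        _ = 4 * edist (F i x) (F j y) := by
            rw [ENNReal.ofReal_mul (by norm_num), ENNReal.ofReal_ofNat, ← edist_dist]

theorem tendsto_intrinsicEDist_D {a b : ℕ → EuclideanSpace ℝ (Fin 2)}
    {x y : EuclideanSpace ℝ (Fin 2)} (han : ∀ n, a n ∈ D n) (hbn : ∀ n, b n ∈ D n)
    (hx : x ∈ gasket) (hy : y ∈ gasket) (ha : Tendsto a atTop (𝓝 x))
    (hb : Tendsto b atTop (𝓝 y)) :
    Tendsto (fun n => intrinsicEDist (D n) (a n) (b n)) atTop (𝓝 (intrinsicEDist gasket x y)) :=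
  tendsto_intrinsicEDist_iInter antitone_D isCompact_D (C := 4)
    (fun n _ hx _ hy => intrinsicEDist_D_le n hx hy) han hbn hx hy ha hb

theorem intrinsicEDist_gasket_ne_top {x y : EuclideanSpace ℝ (Fin 2)} (hx : x ∈ gasket)
    (hy : y ∈ gasket) : intrinsicEDist gasket x y ≠ ∞ := by
  have hx' := Set.mem_iInter.1 hx
  have hy' := Set.mem_iInter.1 hy
  -- The uniform bound passes to the limit along constant sequences.
  have h : intrinsicEDist gasket x y ≤ 4 * edist x y :=
    le_of_tendsto (tendsto_intrinsicEDist_D hx' hy' hx hy tendsto_const_nhds tendsto_const_nhds)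
      (Eventually.of_forall fun n => intrinsicEDist_D_le n (hx' n) (hy' n))
  exact ne_top_of_le_ne_top (ENNReal.mul_ne_top ENNReal.ofNat_ne_top (edist_ne_top _ _)) h

end Sierpinski

theorem mainTheorem9 :
    (∀ n : ℕ, ∀ x ∈ Sierpinski.D n, ∀ y ∈ Sierpinski.D n,
      intrinsicEDist (Sierpinski.D n) x y ≠ ∞) ∧
    (∀ x ∈ Sierpinski.gasket, ∀ y ∈ Sierpinski.gasket,
      intrinsicEDist Sierpinski.gasket x y ≠ ∞) ∧
    ∀ (a b : ℕ → EuclideanSpace ℝ (Fin 2)) (a' b' : EuclideanSpace ℝ (Fin 2)),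
      (∀ n, a n ∈ Sierpinski.D n) → (∀ n, b n ∈ Sierpinski.D n) →
      a' ∈ Sierpinski.gasket → b' ∈ Sierpinski.gasket →
      Tendsto a atTop (𝓝 a') → Tendsto b atTop (𝓝 b') →
      Tendsto (fun n => intrinsicDist (Sierpinski.D n) (a n) (b n)) atTop
        (𝓝 (intrinsicDist Sierpinski.gasket a' b')) := by
  refine ⟨fun n x hx y hy => ?_, fun x hx y hy => Sierpinski.intrinsicEDist_gasket_ne_top hx hy,
    fun a b a' b' han hbn ha' hb' ha hb => ?_⟩
  · exact ne_top_of_le_ne_top (ENNReal.mul_ne_top ENNReal.ofNat_ne_top (edist_ne_top _ _))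
      (Sierpinski.intrinsicEDist_D_le n hx hy)
  · exact (ENNReal.tendsto_toReal (Sierpinski.intrinsicEDist_gasket_ne_top ha' hb')).comp
      (Sierpinski.tendsto_intrinsicEDist_D han hbn ha' hb' ha hb)
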